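/- Fix a finite set $\Sigma$ of node labels and a wildcard symbol $\star\notin\Sigma$. A \emph{tree pattern} is a tuple $p=(N_p,\mathrm{root}_p,\mathrm{lab}_p,\mathrm{child}_p,\mathrm{desc}_p)$ with a finite set $N_p$ of nodes, a root $\mathrm{root}_p\in N_p$, a labeling $\mathrm{lab}_p:N_p\to\Sigma\cup\{\star\}$ and two disjoint sets $\mathrm{child}_p,\mathrm{desc}_p\subseteq N_p\times N_p$ of edges, such that $\mathrm{child}_p\cup\mathrm{desc}_p$ is acyclic and every non-root node has exactly one predecessor in it. The depth of a node is the length of the path from the root to it, and the height of $p$ is the depth of its deepest node. A \emph{tree} is a tree pattern $t$ with $\mathrm{desc}_t=\emptyset$ in which no node is labeled $\star$. A \emph{weakly-injective embedding} of a tree pattern $p$ in a tree $t$ is an injective function $h:N_p\to N_t$ such that $h(\mathrm{root}_p)=\mathrm{root}_t$; $(h(n),h(n'))\in\mathrm{child}_t$ for every $(n,n')\in\mathrm{child}_p$; $(h(n),h(n'))$ belongs to the transitive closure of $\mathrm{child}_t$ for every $(n,n')\in\mathrm{desc}_p$; and $\mathrm{lab}_t(h(n))=\mathrm{lab}_p(n)$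 for every $n\in N_p$ with $\mathrm{lab}_p(n)\neq\star$. Then the decision problem $$\mathcal{M}_{\mathrm{inj}}^{\mathrm{H}\leq 1}=\{(t,p)\mid t\text{ is a tree, }p\text{ is a tree pattern of height at most }1,\text{ and there is a weakly-injective embedding of }p\text{ in }t\}$$ is in P (instances being written as words over a finite alphabet in term notation for trees and bracketed XPath notation for tree patterns). -/

import Mathlib

/-- A tree pattern over a set `S` of node labels. The label `none` is the wildcard `⋆`. -/
structure TreePattern (S : Type) where
  /-- the nodes -/
  N : Type
  /-- there are finitely many nodes -/
  finite_N : Finite N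
  /-- the root node -/
  root : N
  /-- the labeling function, with values in `S ∪ {⋆}` -/
  lab : N → Option S
  /-- the child edges -/
  child : N → N → Prop
  /-- the (proper) descendant edges -/
  desc : N → N → Prop
  /-- no pair of nodes is both a child edge and a descendant edge -/
  disjoint : ∀ m n, ¬ (child m n ∧ desc m n)
  /-- the union of the two edge relations is acyclic -/
  acyclic : ∀ n, ¬ Relation.TransGen (fun a b => child a b ∨ desc a b) n n
  /-- every non-root node has exactly one predecessor -/
  pred : ∀ n, n ≠ root → ∃! m, child m n ∨ desc m n

namespace TreePattern

variable {S : Type}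

/-- `n` is a child of `m` in `p`, through an edge of either kind. -/
def Edge (p : TreePattern S) (m n : p.N) : Prop := p.child m n ∨ p.desc m n

/-- A tree is a tree pattern without descendant edges and without wildcards. -/
def IsTree (t : TreePattern S) : Prop :=
  (∀ m n, ¬ t.desc m n) ∧ ∀ n, t.lab n ≠ none

/-- `p.IsPath m k n`: there is a path of `k` edges from `m` to `n` in `p`. -/
inductive IsPath (p : TreePattern S) (m : p.N) : ℕ → p.N → Prop
  | nil : IsPath p m 0 m
  | snoc {k : ℕ} {n n' : p.N} : IsPath p m k n → p.Edge n n' → IsPath p m (k + 1) n'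

/-- The depth of a node: the length of the (one and only) path from the root to it. -/
noncomputable def depth (p : TreePattern S) (n : p.N) : ℕ := sInf {k | p.IsPath p.root k n}

/-- The height: the depth of the deepest node. -/
noncomputable def height (p : TreePattern S) : ℕ := ⨆ n : p.N, p.depth n

/-- `h` is a (standard) embedding of the tree pattern `p` in the tree `t`. -/
structure IsEmbedding (t p : TreePattern S) (h : p.N → t.N) : Prop where
  map_root : h p.root = t.root
  map_child : ∀ m n, p.child m n → t.child (h m) (h n)
  map_desc : ∀ m n, p.desc m n → Relation.TransGen t.child (h m) (h n)
  map_lab : ∀ n, p.lab n ≠ none → t.lab (h n) = p.lab n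

/-- There is a weakly-injective embedding of `p` in `t`. -/
def WeaklyInjective (t p : TreePattern S) : Prop :=
  ∃ h : p.N → t.N, IsEmbedding t p h ∧ Function.Injective h

/-- Weakly-injective embedding checking for patterns of height at most `k`: the set of the pairs
`(t, p)` of a tree `t` and a tree pattern `p` of height at most `k` such that there is a
weakly-injective embedding of `p` in `t`. -/
def MInjHeight (S : Type) (k : ℕ) : Set (TreePattern S × TreePattern S) :=
  {x | x.1.IsTree ∧ WeaklyInjective x.1 x.2 ∧ x.2.height ≤ k}

/-! ### Tree patterns as words

A tree pattern is written down as in XPath: a node is written as its label, followed by one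
bracketed block for each of its children, `[/ … ]` for a child edge and `[// … ]` for a descendant
edge. For a tree this is the usual notation by unranked terms. -/

/-- The symbols that occur in an instance: a label or the wildcard, the opening brackets `[/` and
`[//`, the closing bracket `]`, and a separator between the tree and the tree pattern. -/
inductive Token (S : Type) : Type
  | label (l : Option S)
  | openChild
  | openDesc
  | close
  | sep

open Classical in
/-- The opening bracket for the edge from `m` to `n`. -/
noncomputable def openBracket (p : TreePattern S) (m n : p.N) : Token S :=
  if p.desc m n then Token.openDesc else Token.openChild

/-- `p.CodeAt n w`: the word `w` is a code of the part of `p` that consists of the descendants of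
`n`. The children of a node can be listed in any order, each of them exactly once. -/
inductive CodeAt (p : TreePattern S) : p.N → List (Token S) → Prop
  | node (n : p.N) (cs : List p.N) (ws : p.N → List (Token S)) :
      cs.Nodup → (∀ m, m ∈ cs ↔ p.Edge n m) → (∀ m ∈ cs, CodeAt p m (ws m)) →
      CodeAt p n (Token.label (p.lab n) ::
        cs.flatMap fun m => p.openBracket n m :: (ws m ++ [Token.close]))

/-- The word `w` is a code of the tree pattern `p`. -/
def IsCode (p : TreePattern S) (w : List (Token S)) : Prop := p.CodeAt p.root w

/-- The decision problem for a set `M` of pairs `(t, p)`, as a set of words: a word belongs to it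
when it consists of a code of `t`, the separator and a code of `p` for some `(t, p)` in `M`. -/
def problemLanguage (M : Set (TreePattern S × TreePattern S)) : Language (Token S) :=
  {w | ∃ t p : TreePattern S, (t, p) ∈ M ∧
    ∃ u v : List (Token S), t.IsCode u ∧ p.IsCode v ∧ w = u ++ Token.sep :: v}

end TreePattern

/-- The complexity class P: the language `L` is decided by a deterministic Turing machine (with
finitely many tapes used as stacks, over finite alphabets) that, on every word `w`, halts with the
answer after a number of steps that is at most a fixed polynomial in the length of `w`. -/
def InP {A : Type} (L : Language A) : Prop :=
  ∃ f : List A → Bool, (∀ w, f w = true ↔ w ∈ L) ∧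
    ∃ c : Turing.TM2ComputableInPolyTime (id : List A → List A) Computability.encodeBool f,
      ∀ k, Finite (c.tm.Γ k)

/-!
For a fixed finite set of labels the problem can be solved in linear time by an automaton with
finitely many counters.

In a pattern of height at most 1 every node other than the root hangs on the root, so a
weakly-injective embedding is an injective map that sends each node of the pattern to a node of the
tree that suits its label and the kind of its edge. Whether a node of the pattern can be mapped to a
node of the tree depends only on their types, where the type of a node consists of its label and its
place (`Place`): the root, a node joined to the root by a child edge, or any other node
(`PatternTerm.weaklyInjective_iff`). There are finitely many types. Hence Hall's marriage theorem
needs one inequality for each set `s` of types only: there are at most as many nodes with type in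
`s` in the pattern as there are nodes in the tree with a type that fits some element of `s`
(`exists_injective_iff_of_types`, `PatternTerm.mem_MInjHeight_iff`).

The automaton `MatchingAutomaton.automaton` keeps a counter for each set `s`, increments it for each
matching node of the tree, decrements it for each node of the pattern with type in `s`, and fails
when the counter is exhausted. One more counter, for the depth, serves to recognize the codes of
trees and to tell the places of their nodes (`MatchingAutomaton.accepts_iff`). A counter automaton is
simulated by a machine with stacks that holds its counters in unary (`CounterAutomaton.inP`).

Codes are handled through `PatternTerm`, which builds a tree pattern by appending children to the
root one after the other: each term denotes a word that is a code of its tree pattern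
(`PatternTerm.isCode_word`), and each tree pattern is isomorphic to that of a term that denotes a
given code of it (`PatternTerm.exists_equiv`).
-/

/-! ### Counter automata -/

/-- What one transition does to one counter. -/
inductive CounterOp
  | keep
  | inc
  | dec

/-- The effect of an operation on the value of a counter; `0` is decremented to `0`. -/
def CounterOp.apply : CounterOp → ℕ → ℕ
  | keep, n => n
  | inc, n => n + 1
  | dec, n => n - 1

/-- A deterministic automaton that reads a word over `A` once, from left to right, with states in
`Q` and one counter for each element of `I`. A transition depends on the state, on the set of
counters that are zero (as a function `I → Bool`) and on the letter. -/
structure CounterAutomaton (A Q I : Type) where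
  /-- the initial state -/
  start : Q
  /-- the new state -/
  next : Q → (I → Bool) → A → Q
  /-- the operation on each counter -/
  op : Q → (I → Bool) → A → I → CounterOp
  /-- the accepting states -/
  accept : Q → Bool

namespace CounterAutomaton

variable {A Q I : Type} (M : CounterAutomaton A Q I)

/-- The zero tests of the counters. -/
def zeros (c : I → ℕ) : I → Bool := fun i => decide (c i = 0)

/-- One transition, on pairs of a state and the values of the counters. -/
def step (x : Q × (I → ℕ)) (a : A) : Q × (I → ℕ) :=
  (M.next x.1 (zeros x.2) a, fun i => (M.op x.1 (zeros x.2) a i).apply (x.2 i))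

/-- The transitions on all letters of a word. -/
def run (x : Q × (I → ℕ)) (w : List A) : Q × (I → ℕ) := w.foldl M.step x

@[simp] theorem run_nil (x : Q × (I → ℕ)) : M.run x [] = x := rfl

@[simp] theorem run_cons (x : Q × (I → ℕ)) (a : A) (w : List A) :
    M.run x (a :: w) = M.run (M.step x a) w := rfl

theorem run_append (x : Q × (I → ℕ)) (u v : List A) :
    M.run x (u ++ v) = M.run (M.run x u) v := List.foldl_append

/-- The automaton accepts the word `w`. All counters are `0` in the beginning. -/
def accepts (w : List A) : Bool := M.accept (M.run (M.start, fun _ => 0) w).1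

/-! ### Simulation of a counter automaton by a machine with stacks -/

/-- The alphabets of the stacks of the machine: an input stack, an output stack, and a stack with
one symbol for each counter. -/
abbrev Alphabet (A I : Type) : Bool ⊕ I → Type :=
  Sum.elim (fun b => cond b Bool A) fun _ => Unit

/-- The internal memory of the machine: the state of the automaton, the zero tests, and the letter
that has just been read, if there is one. -/
abbrev Memory (A Q I : Type) : Type := Q × (I → Bool) × Option A

/-- The contents of the stacks; the value of a counter is in unary. -/
def storage (w : List A) (o : List Bool) (c : I → ℕ) : ∀ k, List (Alphabet A I k)
  | .inl false => w
  | .inl true => o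
  | .inr i => List.replicate (c i) ()

open Turing Turing.TM2

/-- The statements of the machine. The label `true` is for reading the input, `false` is for
clearing the counters. -/
abbrev Stm (A Q I : Type) : Type := Stmt (Alphabet A I) Bool (Memory A Q I)

/-- Test the counters in the list for zero, then go on with `k`. -/
def testAll (l : List I) [DecidableEq I] (k : Stm A Q I) : Stm A Q I :=
  l.foldr (fun i k => .peek (.inr i)
    (fun s o => (s.1, Function.update s.2.1 i o.isNone, s.2.2)) k) k

/-- Apply to each counter in the list an operation that depends on the memory, then go on with
`k`. -/
def opAll (f : Memory A Q I → I → CounterOp) (l : List I) (k : Stm A Q I) : Stm A Q I :=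
  l.foldr (fun i k => .branch (fun s => match f s i with | .inc => true | _ => false)
    (.push (.inr i) (fun _ => ()) k)
    (.branch (fun s => match f s i with | .dec => true | _ => false)
      (.pop (.inr i) (fun s _ => s) k) k)) k

section Semantics

variable (w : List A) (o : List Bool) (c : I → ℕ)

theorem update_input [DecidableEq I] (w' : List A) :
    Function.update (storage w o c) (.inl false) w' = storage w' o c := by
  funext k
  rcases k with (_ | _) | i <;> simp [storage, Function.update]

theorem update_output [DecidableEq I] (o' : List Bool) :
    Function.update (storage w o c) (.inl true) o' = storage w o' c := by
  funext k
  rcases k with (_ | _) | i <;> simp [storage, Function.update]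

theorem update_counter [DecidableEq I] (i : I) (n : ℕ) :
    Function.update (storage w o c) (.inr i) (List.replicate n ()) =
      storage w o (Function.update c i n) := by
  funext k
  rcases k with (_ | _) | j
  · simp [storage, Function.update]
  · simp [storage, Function.update]
  · rcases eq_or_ne j i with rfl | h
    · rw [Function.update_self]
      simp [storage]
    · rw [Function.update_of_ne (by simpa using h)]
      simp [storage, h]

theorem stepAux_testAll [DecidableEq I] (l : List I) (k : Stm A Q I) (q : Q) (z : I → Bool)
    (a : Option A) :
    stepAux (testAll l k) (q, z, a) (storage w o c) =
      stepAux k (q, fun i => if i ∈ l then zeros c i else z i, a) (storage w o c) := by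
  induction l generalizing z with
  | nil => simp [testAll]
  | cons j l ih =>
    have h : (storage w o c (.inr j)).head?.isNone = zeros c j := by
      rcases hc : c j with _ | n <;> simp [storage, zeros, hc, List.replicate_succ]
    have := ih (Function.update z j (zeros c j))
    simp only [testAll, List.foldr_cons, stepAux] at this ⊢
    rw [h, this]
    congr 3
    funext i
    by_cases hi : i ∈ l
    · simp [hi]
    · rcases eq_or_ne i j with rfl | hij <;> simp [*]

theorem stepAux_opAll [DecidableEq I] (f : Memory A Q I → I → CounterOp) (l : List I)
    (hl : l.Nodup) (k : Stm A Q I) (s : Memory A Q I) :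
    stepAux (opAll f l k) s (storage w o c) =
      stepAux k s (storage w o fun i => if i ∈ l then (f s i).apply (c i) else c i) := by
  induction l generalizing c with
  | nil => simp [opAll]
  | cons j l ih =>
    obtain ⟨hj, hl⟩ := List.nodup_cons.1 hl
    have h : stepAux (opAll f (j :: l) k) s (storage w o c) =
        stepAux (opAll f l k) s
          (storage w o (Function.update c j ((f s j).apply (c j)))) := by
      rw [← update_counter]
      simp only [opAll, List.foldr_cons, stepAux]
      rcases f s j with _ | _ | _
      · simp only [cond_false, CounterOp.apply]
        rw [update_counter, Function.update_eq_self]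
      · rfl
      · simp only [cond_false, cond_true, CounterOp.apply]
        congr 2
        simp [storage]
    rw [h, ih _ hl]
    congr 2
    funext i
    rcases eq_or_ne i j with rfl | hij
    · simp [hj]
    · simp [hij]

end Semantics

variable [DecidableEq I] [Fintype I]

/-- The program of the machine. When the input has been read, each step in the label `false`
decrements all counters, until they are all `0`; the output is written in the last step. -/
noncomputable def program : Bool → Stm A Q I
  | true =>
    .pop (.inl false) (fun s a => (s.1, s.2.1, a)) <| testAll Finset.univ.toList <|
      .branch (fun s => s.2.2.isSome)
        (opAll (fun s i => s.2.2.elim .keep fun a => M.op s.1 s.2.1 a i) Finset.univ.toList <|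
          .load (fun s => (s.2.2.elim s.1 fun a => M.next s.1 s.2.1 a, s.2)) <|
          .goto fun _ => true)
        (.goto fun _ => false)
  | false =>
    testAll Finset.univ.toList <|
      .branch (fun s => decide (∀ i, s.2.1 i = true))
        (.push (.inl true) (fun s => M.accept s.1) <|
          .load (fun _ => (M.start, fun _ => true, none)) .halt)
        (opAll (fun _ _ => .dec) Finset.univ.toList <| .goto fun _ => false)

/-- The machine that simulates the automaton. -/
noncomputable def toFinTM2 [Fintype A] [Fintype Q] : FinTM2 where
  K := Bool ⊕ I
  k₀ := .inl false
  k₁ := .inl true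
  Γ := Alphabet A I
  Λ := Bool
  main := true
  σ := Memory A Q I
  initialState := (M.start, fun _ => true, none)
  Γk₀Fin := inferInstanceAs (Fintype A)
  m := M.program

open StateTransition

theorem step_read (q : Q) (z : I → Bool) (b : Option A) (a : A) (w : List A) (c : I → ℕ) :
    TM2.step M.program ⟨some true, (q, z, b), storage (a :: w) [] c⟩ =
      some ⟨some true, ((M.step (q, c) a).1, zeros c, some a),
        storage w [] (M.step (q, c) a).2⟩ := by
  have h : (storage (a :: w) [] c (.inl false)).head? = some a := rfl
  have h' : (storage (a :: w) [] c (.inl false)).tail = w := rfl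
  simp only [TM2.step, program, stepAux]
  rw [h, h', update_input, stepAux_testAll]
  simp only [stepAux, Option.isSome_some, cond_true]
  rw [stepAux_opAll _ _ _ _ _ (Finset.nodup_toList _)]
  simp [stepAux, step]

theorem step_end (q : Q) (z : I → Bool) (b : Option A) (c : I → ℕ) :
    TM2.step M.program ⟨some true, (q, z, b), storage [] [] c⟩ =
      some ⟨some false, (q, zeros c, none), storage [] [] c⟩ := by
  have h : (storage [] [] c (.inl false) : List A).head? = none := rfl
  have h' : Function.update (storage [] [] c) (.inl false) (storage [] [] c (.inl false)).tail =
      (storage [] [] c : ∀ k, List (Alphabet A I k)) := update_input _ _ _ _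
  simp only [TM2.step, program, stepAux]
  rw [h, h']
  refine (congrArg some (stepAux_testAll [] [] c _ _ q z none)).trans ?_
  simp [stepAux]

theorem step_clear (q : Q) (z : I → Bool) (c : I → ℕ) (hc : ∃ i, c i ≠ 0) :
    TM2.step M.program ⟨some false, (q, z, none), storage [] [] c⟩ =
      some ⟨some false, (q, zeros c, none), storage [] [] fun i => c i - 1⟩ := by
  simp only [TM2.step, program]
  rw [stepAux_testAll]
  have : ¬ ∀ i, zeros c i = true := by simpa [zeros] using hc
  simp only [stepAux, Finset.mem_toList, Finset.mem_univ, if_true, this, decide_false, cond_false]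
  rw [stepAux_opAll _ _ _ _ _ (Finset.nodup_toList _)]
  simp [stepAux, CounterOp.apply]

theorem step_halt (q : Q) (z : I → Bool) :
    TM2.step M.program ⟨some false, (q, z, none), storage [] [] fun _ => 0⟩ =
      some ⟨none, (M.start, fun _ => true, none), storage [] [M.accept q] fun _ => 0⟩ := by
  have h : Function.update (storage [] [] fun _ => 0) (.inl true)
      (M.accept q :: storage [] [] (fun _ => 0) (.inl true)) =
      (storage [] [M.accept q] (fun _ => 0) : ∀ k, List (Alphabet A I k)) := update_output _ _ _ _
  simp only [TM2.step, program]
  rw [stepAux_testAll]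
  have : ∀ i : I, zeros (fun _ => 0) i = true := by simp [zeros]
  simp only [stepAux, Finset.mem_toList, Finset.mem_univ, if_true, this, implies_true,
    decide_true, cond_true]
  rw [h]

theorem evalsTo_one {X : Type*} {f : X → Option X} {a b : X} (h : f a = some b) :
    Nonempty (EvalsToInTime f a (some b) 1) :=
  ⟨⟨⟨1, h⟩, le_rfl⟩⟩

theorem evalsTo_clear (n : ℕ) (q : Q) (z : I → Bool) (c : I → ℕ) (hc : ∀ i, c i ≤ n) :
    Nonempty (EvalsToInTime (TM2.step M.program) ⟨some false, (q, z, none), storage [] [] c⟩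
      (some ⟨none, (M.start, fun _ => true, none), storage [] [M.accept q] fun _ => 0⟩)
      (n + 1)) := by
  by_cases h : ∃ i, c i ≠ 0
  · cases n with
    | zero => exact absurd (hc h.choose) (by have := h.choose_spec; omega)
    | succ n =>
      obtain ⟨e₁⟩ := evalsTo_one (M.step_clear q z c h)
      obtain ⟨e₂⟩ := evalsTo_clear n q (zeros c) (fun i => c i - 1)
        fun i => by have := hc i; omega
      exact ⟨EvalsToInTime.trans _ _ _ _ _ _ e₁ e₂⟩
  · have hc : c = fun _ => 0 := by
      funext i
      by_contra hi
      exact h ⟨i, hi⟩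
    subst hc
    obtain ⟨e⟩ := evalsTo_one (M.step_halt q z)
    exact ⟨⟨e.toEvalsTo, e.steps_le_m.trans (by omega)⟩⟩

/-- A counter grows by at most one with each letter, so that the counters are cleared in linear
time. -/
theorem evalsTo_read (w : List A) (n : ℕ) (q : Q) (z : I → Bool) (b : Option A) (c : I → ℕ)
    (hc : ∀ i, c i ≤ n) :
    Nonempty (EvalsToInTime (TM2.step M.program) ⟨some true, (q, z, b), storage w [] c⟩
      (some ⟨none, (M.start, fun _ => true, none),
        storage [] [M.accept (M.run (q, c) w).1] fun _ => 0⟩)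
      (2 * w.length + n + 2)) := by
  induction w generalizing n q z b c with
  | nil =>
    obtain ⟨e₁⟩ := evalsTo_one (M.step_end q z b c)
    obtain ⟨e₂⟩ := M.evalsTo_clear n q (zeros c) c hc
    have e := EvalsToInTime.trans _ _ _ _ _ _ e₁ e₂
    exact ⟨⟨e.toEvalsTo, e.steps_le_m.trans (by simp)⟩⟩
  | cons a w ih =>
    obtain ⟨e₁⟩ := evalsTo_one (M.step_read q z b a w c)
    obtain ⟨e₂⟩ := ih (n + 1) (M.step (q, c) a).1 (zeros c) (some a) (M.step (q, c) a).2 (by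
      intro i
      have := hc i
      simp only [step]
      rcases M.op q (zeros c) a i <;> simp only [CounterOp.apply] <;> omega)
    have e := EvalsToInTime.trans _ _ _ _ _ _ e₁ e₂
    exact ⟨⟨e.toEvalsTo, e.steps_le_m.trans (by simp; omega)⟩⟩

/-- A language that is recognized by a counter automaton is decided in linear time. -/
theorem inP {A Q I : Type} [Finite A] [Finite Q] [Finite I] (M : CounterAutomaton A Q I)
    (L : Language A) (h : ∀ w, M.accepts w = true ↔ w ∈ L) : InP L := by
  classical
  have := Fintype.ofFinite A
  have := Fintype.ofFinite Q
  have := Fintype.ofFinite I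
  refine ⟨M.accepts, h,
    { tm := M.toFinTM2
      inputAlphabet := Equiv.refl A
      outputAlphabet := Equiv.refl Bool
      time := 2 * Polynomial.X + 2
      outputsFun := fun w => Classical.choice ?_ }, ?_⟩
  · obtain ⟨e⟩ := M.evalsTo_read w 0 M.start (fun _ => true) none (fun _ => 0) fun _ => le_rfl
    have h₁ : initList M.toFinTM2 w =
        ⟨some true, (M.start, fun _ => true, none), storage w [] fun _ => 0⟩ := by
      unfold initList
      congr 1
      funext k
      rcases k with (_ | _) | i <;> rfl
    have h₂ : haltList M.toFinTM2 [M.accepts w] =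
        ⟨none, (M.start, fun _ => true, none), storage [] [M.accepts w] fun _ => 0⟩ := by
      unfold haltList
      congr 1
      funext k
      rcases k with (_ | _) | i <;> rfl
    have h₃ : List.map (Equiv.refl A).invFun (id w) = w := List.map_id w
    have h₄ : List.map (Equiv.refl Bool).invFun (Computability.encodeBool (M.accepts w)) =
      [M.accepts w] := rfl
    unfold TM2OutputsInTime
    erw [h₃, h₄, Option.map_some, h₁, h₂]
    refine ⟨⟨e.toEvalsTo, e.steps_le_m.trans ?_⟩⟩
    simp
  · rintro ((_ | _) | i)
    · exact inferInstanceAs (Finite A)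
    · exact inferInstanceAs (Finite Bool)
    · exact inferInstanceAs (Finite Unit)

end CounterAutomaton

/-! ### Paths in tree patterns -/

namespace TreePattern

variable {S : Type} (p : TreePattern S)

theorem wellFounded_edge : WellFounded (Relation.TransGen p.Edge) := by
  have := p.finite_N
  have : Std.Irrefl (Relation.TransGen p.Edge) := ⟨p.acyclic⟩
  exact Finite.wellFounded_of_trans_of_irrefl _

theorem reachable (n : p.N) : Relation.ReflTransGen p.Edge p.root n := by
  induction n using p.wellFounded_edge.induction with
  | _ n ih =>
    by_cases h : n = p.root
    · rw [h]
    · obtain ⟨m, hm, -⟩ := p.pred n h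
      exact (ih m (.single hm)).tail hm

theorem not_edge_root (m : p.N) : ¬ p.Edge m p.root :=
  fun h => p.acyclic _ (Relation.TransGen.tail' (p.reachable m) h)

theorem eq_of_edge {p : TreePattern S} {a b n : p.N} (ha : p.Edge a n) (hb : p.Edge b n) :
    a = b := by
  have h : n ≠ p.root := by
    rintro rfl
    exact p.not_edge_root _ ha
  exact (p.pred n h).unique ha hb

/-- The parts of a tree pattern below two different children of a node are disjoint: otherwise one
of the children is a descendant of the other, because the ancestors of a node form a chain. -/
theorem eq_of_common_descendant {p : TreePattern S} {n a b x : p.N} (ha : p.Edge n a)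
    (hb : p.Edge n b) (hax : Relation.ReflTransGen p.Edge a x)
    (hbx : Relation.ReflTransGen p.Edge b x) : a = b := by
  have key : ∀ {a b}, p.Edge n a → p.Edge n b → Relation.ReflTransGen p.Edge a b → a = b := by
    intro a b ha hb h
    rcases Relation.ReflTransGen.cases_tail h with h | ⟨y, hy, hyb⟩
    · exact h.symm
    · obtain rfl := eq_of_edge hyb hb
      exact absurd (Relation.TransGen.head' ha hy) (p.acyclic _)
  have hU : Relator.RightUnique (Function.swap p.Edge) := fun _ _ _ h₁ h₂ => eq_of_edge h₁ h₂
  rcases Relation.ReflTransGen.total_of_right_unique hU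
    (Relation.reflTransGen_swap.2 hax) (Relation.reflTransGen_swap.2 hbx) with h | h
  · exact (key hb ha (Relation.reflTransGen_swap.1 h)).symm
  · exact key ha hb (Relation.reflTransGen_swap.1 h)

theorem IsPath.unique {p : TreePattern S} {k l : ℕ} {n : p.N} (hk : p.IsPath p.root k n)
    (hl : p.IsPath p.root l n) : k = l := by
  induction hk generalizing l with
  | nil =>
    cases hl with
    | nil => rfl
    | snoc _ e => exact absurd e (p.not_edge_root _)
  | snoc _ e ih =>
    cases hl with
    | nil => exact absurd e (p.not_edge_root _)
    | snoc h e' =>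
      obtain rfl := eq_of_edge e e'
      rw [ih h]

theorem depth_eq {p : TreePattern S} {k : ℕ} {n : p.N} (h : p.IsPath p.root k n) :
    p.depth n = k := by
  have : {k | p.IsPath p.root k n} = {k} :=
    Set.eq_singleton_iff_unique_mem.2 ⟨h, fun _ h' => IsPath.unique h' h⟩
  rw [depth, this, csInf_singleton]

theorem exists_isPath (n : p.N) : ∃ k, p.IsPath p.root k n := by
  induction p.reachable n with
  | refl => exact ⟨0, .nil⟩
  | tail _ e ih => exact ⟨_, ih.choose_spec.snoc e⟩

theorem height_le_one_iff : p.height ≤ 1 ↔ ∀ m n, p.Edge m n → m = p.root := by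
  constructor
  · intro h m n e
    obtain ⟨k, hk⟩ := p.exists_isPath m
    have := p.finite_N
    have h₁ : p.depth n ≤ p.height := le_ciSup (Set.finite_range p.depth).bddAbove n
    rw [depth_eq (hk.snoc e)] at h₁
    obtain rfl : k = 0 := by omega
    cases hk
    rfl
  · intro h
    have : Nonempty p.N := ⟨p.root⟩
    refine ciSup_le fun n => ?_
    obtain ⟨k, hk⟩ := p.exists_isPath n
    rw [depth_eq hk]
    cases hk with
    | nil => exact Nat.zero_le _
    | snoc hm e =>
      obtain rfl := h _ _ e
      rw [hm.unique .nil]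

/-- A code is carried over to another tree pattern by an injective map that preserves labels,
brackets and the lists of children, at least on a set `D` of nodes that is closed under taking
children. -/
theorem CodeAt.map {p q : TreePattern S} (f : p.N → q.N) (hf : Function.Injective f)
    (D : p.N → Prop) (hlab : ∀ x, q.lab (f x) = p.lab x)
    (hbr : ∀ x y, p.Edge x y → q.openBracket (f x) (f y) = p.openBracket x y)
    (hedge : ∀ x, D x → ∀ m, q.Edge (f x) m ↔ ∃ y, m = f y ∧ p.Edge x y)
    (hD : ∀ x y, D x → p.Edge x y → D y) {x : p.N} {w : List (Token S)} (h : p.CodeAt x w)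
    (hx : D x) : q.CodeAt (f x) w := by
  induction h with
  | node n cs ws hcs hmem _ ih =>
    have := CodeAt.node (p := q) (f n) (cs.map f) (Function.extend f ws fun _ => []) (hcs.map hf)
      (fun m => by simp [hedge n hx, hmem, and_comm, eq_comm])
      (fun m hm => by
        obtain ⟨y, hy, rfl⟩ := List.mem_map.1 hm
        rw [hf.extend_apply]
        exact ih y hy (hD _ _ hx ((hmem y).1 hy)))
    rw [List.flatMap_map, hlab] at this
    convert this using 2
    refine List.flatMap_congr fun m hm => ?_
    rw [hbr _ _ ((hmem m).1 hm), hf.extend_apply]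

/-- If `q` consists of (a copy of) `p` and one more child `z` of the root with its descendants,
then a code of `p` can be extended to a code of `q`. -/
theorem CodeAt.append {p q : TreePattern S} (f : p.N → q.N) (hf : Function.Injective f) (z : q.N)
    (hz : ∀ x, f x ≠ z) (hlab : ∀ x, q.lab (f x) = p.lab x)
    (hbr : ∀ x y, p.Edge x y → q.openBracket (f x) (f y) = p.openBracket x y)
    (hedge : ∀ x m, q.Edge (f x) m ↔ (∃ y, m = f y ∧ p.Edge x y) ∨ x = p.root ∧ m = z)
    {v w : List (Token S)} (h : p.CodeAt p.root w) (hv : q.CodeAt z v) :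
    q.CodeAt (f p.root) (w ++ q.openBracket (f p.root) z :: (v ++ [.close])) := by
  classical
  generalize hr : p.root = r at h
  cases h with
  | node n cs ws hcs hmem hws =>
    subst hr
    have hne : ∀ y ∈ cs, y ≠ p.root := by
      rintro y hy rfl
      exact p.not_edge_root _ ((hmem _).1 hy)
    have := CodeAt.node (p := q) (f p.root) (cs.map f ++ [z])
      (fun m => if m = z then v else Function.extend f ws (fun _ => []) m)
      ((hcs.map hf).append (List.nodup_singleton _) (by simpa using fun x _ => hz x))
      (fun m => by simp [hedge, hmem, and_comm, eq_comm])
      (fun m hm => by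
        rcases List.mem_append.1 hm with hm | hm
        · obtain ⟨y, hy, rfl⟩ := List.mem_map.1 hm
          rw [if_neg (hz y), hf.extend_apply]
          refine (hws y hy).map f hf (· ≠ p.root) hlab hbr ?_ ?_ (hne y hy)
          · intro x hx m
            simp [hedge, hx]
          · rintro x _ - e rfl
            exact p.not_edge_root _ e
        · obtain rfl := List.mem_singleton.1 hm
          rwa [if_pos rfl])
    rw [List.flatMap_append, List.flatMap_map, hlab] at this
    convert this using 1
    rw [List.cons_append]
    congr 2
    · refine List.flatMap_congr fun m hm => ?_
      rw [hbr _ _ ((hmem m).1 hm), if_neg (hz m), hf.extend_apply]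
    · simp

end TreePattern

/-! ### Terms -/

/-- A term for a tree pattern with ordered children. The children of the root are appended one
after the other. -/
inductive PatternTerm (S : Type) : Type
  /-- a single node -/
  | leaf (l : Option S)
  /-- `graft T b U` is `T` with `U` as an additional last child of the root, through a descendant
  edge if `b` is true and through a child edge otherwise. -/
  | graft (T : PatternTerm S) (b : Bool) (U : PatternTerm S)

namespace PatternTerm

variable {S : Type}

/-- The opening bracket for a descendant edge if `b` is true, and for a child edge otherwise. -/
def bracket (S : Type) (b : Bool) : TreePattern.Token S := cond b .openDesc .openChild

/-- The word that is denoted by a term. -/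
def word : PatternTerm S → List (TreePattern.Token S)
  | leaf l => [.label l]
  | graft T b U => word T ++ bracket S b :: (word U ++ [.close])

/-- The nodes of a term. -/
def Node : PatternTerm S → Type
  | leaf _ => Unit
  | graft T _ U => Node T ⊕ Node U

instance instFintypeNode : ∀ T : PatternTerm S, Fintype T.Node
  | leaf _ => inferInstanceAs (Fintype Unit)
  | graft T _ U =>
    have := instFintypeNode T
    have := instFintypeNode U
    inferInstanceAs (Fintype (T.Node ⊕ U.Node))

/-- The root of a term. -/
def root : ∀ T : PatternTerm S, T.Node
  | leaf _ => ()
  | graft T _ _ => .inl (root T)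

/-- The labels of the nodes. -/
def lab : ∀ T : PatternTerm S, T.Node → Option S
  | leaf l, _ => l
  | graft T _ U, x => Sum.elim (lab T) (lab U) x

/-- `T.Link b x y`: there is an edge from `x` to `y`, a descendant edge if `b` is true and a child
edge otherwise. -/
inductive Link : ∀ T : PatternTerm S, Bool → T.Node → T.Node → Prop
  | left {T b U c x y} : Link T c x y → Link (graft T b U) c (.inl x) (.inl y)
  | right {T b U c x y} : Link U c x y → Link (graft T b U) c (.inr x) (.inr y)
  | new {T b U} : Link (graft T b U) b (.inl (root T)) (.inr (root U))

theorem link_left {T U : PatternTerm S} {b c : Bool} {x : (graft T b U).Node} {y : T.Node} :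
    Link (graft T b U) c x (.inl y) ↔ ∃ x', x = .inl x' ∧ Link T c x' y := by
  constructor
  · intro h
    cases h with
    | left h => exact ⟨_, rfl, h⟩
  · rintro ⟨x', rfl, h⟩
    exact .left h

theorem link_right {T U : PatternTerm S} {b c : Bool} {x : (graft T b U).Node} {y : U.Node} :
    Link (graft T b U) c x (.inr y) ↔
      (∃ x', x = .inr x' ∧ Link U c x' y) ∨ x = .inl T.root ∧ y = U.root ∧ c = b := by
  constructor
  · intro h
    cases h with
    | right h => exact .inl ⟨_, rfl, h⟩
    | new => exact .inr ⟨rfl, rfl, rfl⟩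
  · rintro (⟨x', rfl, h⟩ | ⟨rfl, rfl, rfl⟩)
    · exact .right h
    · exact .new

theorem not_link_leaf {l : Option S} {b : Bool} {x y : (leaf l).Node} : ¬ Link (leaf l) b x y := by
  intro h
  cases h

theorem not_link_root {T : PatternTerm S} {b : Bool} {x : T.Node} : ¬ Link T b x T.root := by
  induction T with
  | leaf l => exact not_link_leaf
  | graft T c U ih _ =>
    intro h
    obtain ⟨x', -, h⟩ := link_left.1 h
    exact ih h

theorem exists_link {T : PatternTerm S} {y : T.Node} (hy : y ≠ T.root) : ∃ b x, Link T b x y := by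
  induction T with
  | leaf l => exact absurd rfl hy
  | graft T c U ihT ihU =>
    rcases y with y | y
    · obtain ⟨b, x, h⟩ := ihT (y := y) fun h => hy (congrArg Sum.inl h)
      exact ⟨b, _, .left h⟩
    · by_cases h : y = U.root
      · subst h
        exact ⟨c, _, .new⟩
      · obtain ⟨b, x, h⟩ := ihU h
        exact ⟨b, _, .right h⟩

theorem link_unique {T : PatternTerm S} {b b' : Bool} {x x' y : T.Node} (h : Link T b x y)
    (h' : Link T b' x' y) : x = x' ∧ b = b' := by
  induction h with
  | left _ ih =>
    obtain ⟨z, rfl, hz⟩ := link_left.1 h'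
    obtain ⟨rfl, rfl⟩ := ih hz
    exact ⟨rfl, rfl⟩
  | right h ih =>
    rcases link_right.1 h' with ⟨z, rfl, hz⟩ | ⟨-, rfl, -⟩
    · obtain ⟨rfl, rfl⟩ := ih hz
      exact ⟨rfl, rfl⟩
    · exact absurd h not_link_root
  | new =>
    rcases link_right.1 h' with ⟨z, -, h'⟩ | ⟨rfl, -, rfl⟩
    · exact absurd h' not_link_root
    · exact ⟨rfl, rfl⟩

/-- The number of edges from the root to a node. -/
def level : ∀ T : PatternTerm S, T.Node → ℕ
  | leaf _, _ => 0
  | graft T _ U, x => Sum.elim (level T) (fun y => level U y + 1) x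

theorem level_root (T : PatternTerm S) : T.level T.root = 0 := by
  induction T with
  | leaf l => rfl
  | graft T b U ih _ => exact ih

theorem level_of_link {T : PatternTerm S} {b : Bool} {x y : T.Node} (h : Link T b x y) :
    T.level y = T.level x + 1 := by
  induction h with
  | left _ ih => exact ih
  | right _ ih => exact congrArg (· + 1) ih
  | @new T b U =>
    have h₁ : (graft T b U).level (.inl T.root) = T.level T.root := rfl
    have h₂ : (graft T b U).level (.inr U.root) = U.level U.root + 1 := rfl
    rw [h₁, h₂, level_root, level_root]

/-- The tree pattern that is denoted by a term. -/
def toPattern (T : PatternTerm S) : TreePattern S where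
  N := T.Node
  finite_N := inferInstance
  root := T.root
  lab := T.lab
  child := T.Link false
  desc := T.Link true
  disjoint _ _ h := nomatch (link_unique h.1 h.2).2
  acyclic n h := by
    have key : ∀ m, Relation.TransGen (fun a b => T.Link false a b ∨ T.Link true a b) n m →
        T.level n < T.level m := by
      intro m hm
      induction hm with
      | single e => rcases e with e | e <;> have := level_of_link e <;> omega
      | tail _ e ih => rcases e with e | e <;> have := level_of_link e <;> omega
    exact lt_irrefl _ (key n h)
  pred n hn := by
    obtain ⟨b, x, h⟩ := exists_link hn
    refine ⟨x, by cases b <;> simp [h], ?_⟩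
    rintro y (h' | h') <;> exact (link_unique h' h).1

theorem edge_iff {T : PatternTerm S} {x y : T.Node} :
    T.toPattern.Edge x y ↔ ∃ b, T.Link b x y := by
  rw [Bool.exists_bool]
  rfl

theorem openBracket_eq {T : PatternTerm S} {b : Bool} {x y : T.Node} (h : T.Link b x y) :
    T.toPattern.openBracket x y = bracket S b := by
  cases b with
  | true => exact if_pos h
  | false =>
    have h' : ¬ T.toPattern.desc x y := fun h' => nomatch (link_unique h h').2
    exact if_neg h'

/-! ### Terms and codes -/

open TreePattern

theorem codeAt_right (T : PatternTerm S) (b : Bool) {U : PatternTerm S} {y : U.toPattern.N}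
    {w : List (Token S)} (h : U.toPattern.CodeAt y w) :
    (graft T b U).toPattern.CodeAt (Sum.inr y : T.Node ⊕ U.Node) w := by
  refine h.map (q := (graft T b U).toPattern) (fun y => (Sum.inr y : T.Node ⊕ U.Node))
    Sum.inr_injective (fun _ => True) (fun _ => rfl) (fun x y e => ?_) (fun x _ m => ?_)
    (fun _ _ _ _ => trivial) trivial
  · obtain ⟨c, e⟩ := edge_iff.1 e
    exact (openBracket_eq (.right e)).trans (openBracket_eq e).symm
  · refine edge_iff.trans ⟨fun ⟨c, e⟩ => ?_, fun ⟨y, hm, e⟩ => ?_⟩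
    · cases e with
      | right e => exact ⟨_, rfl, edge_iff.2 ⟨c, e⟩⟩
    · subst hm
      obtain ⟨c, e⟩ := edge_iff.1 e
      exact ⟨c, .right e⟩

theorem edge_left_iff {T : PatternTerm S} {b : Bool} {U : PatternTerm S} {x : T.Node}
    {m : (graft T b U).Node} : (graft T b U).toPattern.Edge (Sum.inl x : T.Node ⊕ U.Node) m ↔
      (∃ y : T.Node, m = (Sum.inl y : T.Node ⊕ U.Node) ∧ T.toPattern.Edge x y) ∨
        x = T.root ∧ m = (Sum.inr U.root : T.Node ⊕ U.Node) := by
  refine edge_iff.trans ⟨fun ⟨c, e⟩ => ?_, ?_⟩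
  · cases e with
    | left e => exact .inl ⟨_, rfl, edge_iff.2 ⟨c, e⟩⟩
    | new => exact .inr ⟨rfl, rfl⟩
  · rintro (⟨y, hm, e⟩ | ⟨rfl, hm⟩)
    · subst hm
      obtain ⟨c, e⟩ := edge_iff.1 e
      exact ⟨c, .left e⟩
    · subst hm
      exact ⟨b, .new⟩

theorem isCode_word (T : PatternTerm S) : T.toPattern.IsCode T.word := by
  induction T with
  | leaf l =>
    refine CodeAt.node (p := (leaf l).toPattern) (leaf l).root [] (fun _ => []) List.nodup_nil ?_
      (by simp)
    intro m
    simp only [List.not_mem_nil, false_iff]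
    intro e
    obtain ⟨c, e⟩ := edge_iff.1 e
    exact not_link_leaf e
  | graft T b U ihT ihU =>
    have hb := openBracket_eq (.new : Link (graft T b U) b (.inl T.root) (.inr U.root))
    have h₁ := CodeAt.append (p := T.toPattern) (q := (graft T b U).toPattern)
      (fun x => (Sum.inl x : T.Node ⊕ U.Node)) Sum.inl_injective
      (Sum.inr U.root : T.Node ⊕ U.Node) (fun _ => Sum.inl_ne_inr) (fun _ => rfl)
      (fun x y e => by
        obtain ⟨c, e⟩ := edge_iff.1 e
        exact (openBracket_eq (.left e)).trans (openBracket_eq e).symm)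
      (fun x m => edge_left_iff) ihT (codeAt_right T b ihU)
    have h₂ : (graft T b U).word = T.word ++
      (graft T b U).toPattern.openBracket (Sum.inl T.root : T.Node ⊕ U.Node)
        (Sum.inr U.root : T.Node ⊕ U.Node) :: (U.word ++ [.close]) := by
      rw [word]
      exact congrArg (fun t => T.word ++ t :: (U.word ++ [.close])) hb.symm
    unfold IsCode
    rw [h₂]
    exact h₁

/-- `e` is an embedding of the term `T` in `p` as a part of `p`: it preserves labels and both kinds
of edges. -/
structure IsPart (T : PatternTerm S) (p : TreePattern S) (e : T.Node → p.N) : Prop where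
  injective : Function.Injective e
  map_lab : ∀ x, p.lab (e x) = T.lab x
  map_link : ∀ b x y, T.Link b x y → cond b p.desc p.child (e x) (e y)

/-- The children of `n` in the list `cs` are grafted one by one; the images of the grafted terms are
disjoint by `eq_of_common_descendant`. -/
theorem exists_isPart_of_list {p : TreePattern S} (n : p.N) (ws : p.N → List (Token S))
    (cs : List p.N) (hcs : cs.Nodup) (hedge : ∀ m ∈ cs, p.Edge n m)
    (h : ∀ m ∈ cs, ∃ T : PatternTerm S, T.word = ws m ∧ ∃ e : T.Node → p.N, IsPart T p e ∧
      e T.root = m ∧ ∀ k, (∃ x, e x = k) ↔ Relation.ReflTransGen p.Edge m k) :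
    ∃ T : PatternTerm S,
      T.word = .label (p.lab n) :: cs.flatMap (fun m => p.openBracket n m :: (ws m ++ [.close])) ∧
      ∃ e : T.Node → p.N, IsPart T p e ∧ e T.root = n ∧
        ∀ k, (∃ x, e x = k) ↔ k = n ∨ ∃ m ∈ cs, Relation.ReflTransGen p.Edge m k := by
  induction cs using List.reverseRecOn with
  | nil =>
    refine ⟨leaf (p.lab n), rfl, fun _ => n, ⟨fun _ _ _ => rfl, fun _ => rfl, ?_⟩, rfl, ?_⟩
    · intro b x y hl
      exact absurd hl not_link_leaf
    · intro k
      simp only [List.not_mem_nil, false_and, exists_false, or_false]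
      exact ⟨fun ⟨_, hx⟩ => hx.symm, fun hk => ⟨(), hk.symm⟩⟩
  | append_singleton cs m ih =>
    classical
    obtain ⟨T, hTw, e, he, her, hek⟩ := ih (List.nodup_append.1 hcs).1
      (fun m hm => hedge m (by simp [hm])) fun m hm => h m (by simp [hm])
    obtain ⟨U, hUw, f, hf, hfr, hfk⟩ := h m (by simp)
    have hm : m ∉ cs := by
      rw [List.nodup_append] at hcs
      exact fun hm => hcs.2.2 m hm m (by simp) rfl
    have hnm : p.Edge n m := hedge m (by simp)
    refine ⟨graft T (decide (p.desc n m)) U, ?_, Sum.elim e f, ⟨?_, ?_, ?_⟩, her, ?_⟩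
    · rw [word, hTw, hUw]
      have : bracket S (decide (p.desc n m)) = p.openBracket n m := by
        by_cases hd : p.desc n m <;> simp [hd, bracket, openBracket]
      simp [this]
    · refine he.injective.sumElim hf.injective fun x y hxy => ?_
      have hy := (hfk (f y)).1 ⟨y, rfl⟩
      rcases (hek (e x)).1 ⟨x, rfl⟩ with hx | ⟨m', hm', hx⟩
      · rw [← hxy, hx] at hy
        exact p.acyclic _ (Relation.TransGen.head' hnm hy)
      · rw [hxy] at hx
        exact hm (eq_of_common_descendant hnm (hedge m' (by simp [hm'])) hy hx ▸ hm')
    · rintro (x | x)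
      · exact he.map_lab x
      · exact hf.map_lab x
    · intro b x y hl
      cases hl with
      | left hl => exact he.map_link _ _ _ hl
      | right hl => exact hf.map_link _ _ _ hl
      | new =>
        have h₁ : Sum.elim e f (Sum.inl T.root) = n := her
        have h₂ : Sum.elim e f (Sum.inr U.root) = m := hfr
        rw [h₁, h₂]
        by_cases hd : p.desc n m
        · simp [hd]
        · simpa [hd] using hnm.resolve_right hd
    · intro k
      have h₁ : (∃ x, Sum.elim e f x = k) ↔ (∃ x, e x = k) ∨ ∃ x, f x = k := Sum.exists
      refine h₁.trans ?_
      rw [hek, hfk]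
      simp only [List.mem_append, List.mem_singleton, or_and_right, exists_or, exists_eq_left,
        or_assoc]

theorem exists_isPart {p : TreePattern S} {n : p.N} {w : List (Token S)} (h : p.CodeAt n w) :
    ∃ T : PatternTerm S, T.word = w ∧ ∃ e : T.Node → p.N, IsPart T p e ∧
      e T.root = n ∧ ∀ k, (∃ x, e x = k) ↔ Relation.ReflTransGen p.Edge n k := by
  induction h with
  | node n cs ws hcs hmem _ ih =>
    obtain ⟨T, hT, e, he, her, hek⟩ :=
      exists_isPart_of_list n ws cs hcs (fun m hm => (hmem m).1 hm) ih
    refine ⟨T, hT, e, he, her, fun k => ?_⟩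
    rw [hek, Relation.ReflTransGen.cases_head_iff]
    simp only [hmem, eq_comm]

/-- Every tree pattern with code `w` is isomorphic to the tree pattern of a term that denotes
`w`. -/
theorem exists_equiv {p : TreePattern S} {w : List (Token S)} (h : p.IsCode w) :
    ∃ T : PatternTerm S, T.word = w ∧ ∃ e : T.Node ≃ p.N, e T.root = p.root ∧
      (∀ x, p.lab (e x) = T.lab x) ∧ (∀ x y, p.child (e x) (e y) ↔ T.Link false x y) ∧
      ∀ x y, p.desc (e x) (e y) ↔ T.Link true x y := by
  obtain ⟨T, hT, e, he, her, hek⟩ := exists_isPart h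
  refine ⟨T, hT, Equiv.ofBijective e ⟨he.injective, fun k => (hek k).2 (p.reachable k)⟩, her,
    he.map_lab, ?_⟩
  -- an edge of `p` is the image of an edge of `T` because predecessors are unique
  have key : ∀ b x y, cond b p.desc p.child (e x) (e y) ↔ T.Link b x y := by
    refine fun b x y => ⟨fun hb => ?_, he.map_link b x y⟩
    have hE : ∀ {b x y}, cond b p.desc p.child (e x) (e y) → p.Edge (e x) (e y) := by
      rintro (_ | _) x y hb
      exacts [.inl hb, .inr hb]
    have hy : y ≠ T.root := by
      rintro rfl
      rw [her] at hb
      exact p.not_edge_root (e x) (by cases b; exacts [.inl hb, .inr hb])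
    obtain ⟨c, z, hz⟩ := exists_link hy
    have hc := he.map_link _ _ _ hz
    obtain rfl := he.injective (eq_of_edge (hE hb) (hE hc))
    cases b <;> cases c
    · exact hz
    · exact absurd ⟨hb, hc⟩ (p.disjoint _ _)
    · exact absurd ⟨hc, hb⟩ (p.disjoint _ _)
    · exact hz
  exact ⟨key false, key true⟩

/-- The problem is the same for terms as it is for tree patterns. -/
theorem mem_problemLanguage (w : List (Token S)) :
    w ∈ problemLanguage (MInjHeight S 1) ↔ ∃ T U : PatternTerm S,
      (T.toPattern, U.toPattern) ∈ MInjHeight S 1 ∧ w = T.word ++ .sep :: U.word := by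
  constructor
  · rintro ⟨t, p, ⟨ht, ⟨h, hemb, hinj⟩, hh⟩, u, v, hu, hv, rfl⟩
    obtain ⟨T, rfl, e, her, hel, hec, hed⟩ := exists_equiv hu
    obtain ⟨U, rfl, f, hfr, hfl, hfc, hfd⟩ := exists_equiv hv
    refine ⟨T, U, ⟨⟨?_, ?_⟩, ⟨fun x => e.symm (h (f x)), ⟨?_, ?_, ?_, ?_⟩, ?_⟩, ?_⟩, rfl⟩
    · exact fun m n hmn => ht.1 _ _ ((hed m n).2 hmn)
    · intro n
      exact (hel n).symm.trans_ne (ht.2 (e n))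
    · refine e.symm_apply_eq.2 ?_
      have : f U.toPattern.root = p.root := hfr
      rw [this, hemb.map_root]
      exact her.symm
    · intro m n hmn
      refine (hec _ _).1 ?_
      rw [e.apply_symm_apply, e.apply_symm_apply]
      exact hemb.map_child _ _ ((hfc _ _).2 hmn)
    · intro m n hmn
      refine (hemb.map_desc _ _ ((hfd _ _).2 hmn)).lift e.symm fun a b hab => (hec _ _).1 ?_
      rwa [e.apply_symm_apply, e.apply_symm_apply]
    · intro n hn
      have h₁ := hfl n
      have h₂ := hel (e.symm (h (f n)))
      rw [e.apply_symm_apply] at h₂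
      refine h₂.symm.trans ((hemb.map_lab _ ?_).trans h₁)
      exact h₁.trans_ne hn
    · exact e.symm.injective.comp (hinj.comp f.injective)
    · rw [height_le_one_iff] at hh ⊢
      intro m n hmn
      refine f.injective ((hh (f m) (f n) ?_).trans hfr.symm)
      exact hmn.imp (hfc _ _).2 (hfd _ _).2
  · rintro ⟨T, U, h, rfl⟩
    exact ⟨_, _, h, _, _, isCode_word T, isCode_word U, rfl⟩

end PatternTerm

/-! ### Node types and Hall's condition -/

/-- The position of a node relative to the root: the root itself, a node that is joined to the root
by a child edge, or any other node. -/
inductive Place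
  | root
  | child
  | deep

/-- The place of a node that is joined to a node at the given place by a descendant edge (if the
Boolean is true) or by a child edge. -/
def Place.next : Place → Bool → Place
  | root, false => child
  | _, _ => deep

theorem Place.next_ne_root (q : Place) (b : Bool) : q.next b ≠ root := by
  cases q <;> cases b <;> simp [next]

theorem Place.next_eq_child {q : Place} {b : Bool} : q.next b = child ↔ q = root ∧ b = false := by
  cases q <;> cases b <;> simp [next]

instance : Finite Place :=
  Finite.of_surjective (fun i : Fin 3 => match i with | 0 => .root | 1 => .child | 2 => .deep) (by
    rintro (_ | _ | _)
    exacts [⟨0, rfl⟩, ⟨1, rfl⟩, ⟨2, rfl⟩])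

/-- Hall's marriage theorem when it depends only on the types of `x` and `y` whether `x` and `y` fit
together. One inequality for each set of types is sufficient. -/
theorem exists_injective_iff_of_types {X Y A B : Type} [Fintype X] [Fintype Y] (σ : X → A)
    (τ : Y → B) (r : A → B → Prop) :
    (∃ f : X → Y, Function.Injective f ∧ ∀ x, r (σ x) (τ (f x))) ↔
      ∀ s : Set A, Nat.card {x // σ x ∈ s} ≤ Nat.card {y // ∃ a ∈ s, r a (τ y)} := by
  classical
  constructor
  · rintro ⟨f, hf, h⟩ s
    exact Nat.card_le_card_of_injective
      (fun x : {x // σ x ∈ s} => (⟨f x, _, x.2, h x⟩ : {y // ∃ a ∈ s, r a (τ y)}))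
      fun x y hxy => Subtype.ext (hf (congrArg Subtype.val hxy))
  · intro h
    have := (Finset.all_card_le_biUnion_card_iff_exists_injective
      fun x : X => Finset.univ.filter fun y : Y => r (σ x) (τ y)).1 ?_
    · simpa using this
    · intro s
      have hs := h (σ '' s)
      rw [Nat.card_eq_fintype_card, Nat.card_eq_fintype_card, Fintype.card_subtype,
        Fintype.card_subtype] at hs
      refine (Finset.card_le_card fun x hx => ?_).trans (hs.trans (Finset.card_le_card ?_))
      · simpa using ⟨x, hx, rfl⟩
      · intro y hy
        simpa using hy

namespace PatternTerm

variable {S : Type}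

/-- The places of the nodes, given the place of the root. -/
def place : ∀ T : PatternTerm S, Place → T.Node → Place
  | leaf _, q, _ => q
  | graft T b U, q, x => Sum.elim (place T q) (place U (q.next b)) x

theorem place_root (T : PatternTerm S) (q : Place) : T.place q T.root = q := by
  induction T with
  | leaf l => rfl
  | graft T b U ih _ => exact ih

theorem place_of_link {T : PatternTerm S} {q : Place} {b : Bool} {x y : T.Node}
    (h : T.Link b x y) : T.place q y = (T.place q x).next b := by
  induction h generalizing q with
  | left _ ih => exact ih
  | right _ ih => exact ih
  | @new T b U =>
    have h₁ : (graft T b U).place q (.inl T.root) = T.place q T.root := rfl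
    have h₂ : (graft T b U).place q (.inr U.root) = U.place (q.next b) U.root := rfl
    rw [h₁, h₂, place_root, place_root]

theorem place_eq_root {T : PatternTerm S} {x : T.Node} :
    T.place .root x = .root ↔ x = T.root := by
  constructor
  · intro h
    by_contra hx
    obtain ⟨b, y, hl⟩ := exists_link hx
    exact Place.next_ne_root _ _ ((place_of_link hl).symm.trans h)
  · rintro rfl
    exact T.place_root _

theorem place_eq_child {T : PatternTerm S} {x : T.Node} :
    T.place .root x = .child ↔ T.Link false T.root x := by
  constructor
  · intro h
    have hx : x ≠ T.root := by
      rintro rfl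
      rw [place_root] at h
      cases h
    obtain ⟨b, y, hl⟩ := exists_link hx
    obtain ⟨hy, rfl⟩ := Place.next_eq_child.1 ((place_of_link hl).symm.trans h)
    rwa [← place_eq_root.1 hy]
  · intro h
    rw [place_of_link h, place_root]
    rfl

/-- The number of nodes whose place and label form a pair in `s`, given the place of the root. -/
noncomputable def count (s : Set (Place × Option S)) : PatternTerm S → Place → ℕ
  | leaf l, q => open Classical in if (q, l) ∈ s then 1 else 0
  | graft T b U, q => count s T q + count s U (q.next b)

theorem count_eq_card (s : Set (Place × Option S)) (T : PatternTerm S) (q : Place) :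
    T.count s q = Nat.card {x // (T.place q x, T.lab x) ∈ s} := by
  classical
  have key : T.count s q = ∑ x, if (T.place q x, T.lab x) ∈ s then 1 else 0 := by
    induction T generalizing q with
    | leaf l =>
      exact (Fintype.sum_unique (ι := Unit) fun _ => if (q, l) ∈ s then 1 else 0).symm
    | graft T b U ihT ihU =>
      rw [count, ihT, ihU]
      exact (Fintype.sum_sum_type (α₁ := T.Node) (α₂ := U.Node) fun x =>
        if ((graft T b U).place q x, (graft T b U).lab x) ∈ s then 1 else 0).symm
  rw [key, Nat.card_eq_fintype_card, Fintype.card_subtype, Finset.card_filter]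

/-- There are neither wildcards nor descendant edges. -/
def Proper : PatternTerm S → Prop
  | leaf l => l ≠ none
  | graft T b U => Proper T ∧ b = false ∧ Proper U

/-- All edges start at the root. -/
def Flat : PatternTerm S → Prop
  | leaf _ => True
  | graft T _ U => Flat T ∧ ∃ l, U = leaf l

theorem isTree_iff (T : PatternTerm S) : T.toPattern.IsTree ↔ T.Proper := by
  have key : T.Proper ↔ (∀ x y, ¬ T.Link true x y) ∧ ∀ x, T.lab x ≠ none := by
    induction T with
    | leaf l => exact ⟨fun h => ⟨fun _ _ => not_link_leaf, fun _ => h⟩, fun h => h.2 ()⟩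
    | graft T b U ihT ihU =>
      rw [Proper, ihT, ihU]
      constructor
      · rintro ⟨⟨h₁, h₂⟩, rfl, h₃, h₄⟩
        refine ⟨fun x y hl => ?_, ?_⟩
        · cases hl with
          | left hl => exact h₁ _ _ hl
          | right hl => exact h₃ _ _ hl
        · rintro (x | x)
          exacts [h₂ x, h₄ x]
      · rintro ⟨h₁, h₂⟩
        refine ⟨⟨fun _ _ hl => h₁ _ _ (.left hl), fun x => h₂ (.inl x)⟩, ?_,
          fun _ _ hl => h₁ _ _ (.right hl), fun x => h₂ (.inr x)⟩
        cases b
        · rfl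
        · exact absurd .new (h₁ _ _)
  exact key.symm

theorem flat_iff (T : PatternTerm S) : T.Flat ↔ ∀ b x y, T.Link b x y → x = T.root := by
  induction T with
  | leaf l => exact ⟨fun _ _ _ _ h => absurd h not_link_leaf, fun _ => trivial⟩
  | graft T b U ihT ihU =>
    rw [Flat, ihT]
    constructor
    · rintro ⟨h, l, rfl⟩ c x y hl
      cases hl with
      | left hl => exact congrArg Sum.inl (h _ _ _ hl)
      | right hl => exact absurd hl not_link_leaf
      | new => rfl
    · intro h
      refine ⟨fun c x y hl => Sum.inl_injective (h _ _ _ (.left hl)), ?_⟩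
      cases U with
      | leaf l => exact ⟨l, rfl⟩
      | graft U c V => exact absurd (h _ _ _ (.right .new)) Sum.inr_ne_inl

theorem height_le_one_iff (T : PatternTerm S) : T.toPattern.height ≤ 1 ↔ T.Flat := by
  rw [TreePattern.height_le_one_iff, flat_iff]
  constructor
  · exact fun h b x y hl => h x y (edge_iff.2 ⟨b, hl⟩)
  · intro h x y e
    obtain ⟨b, hl⟩ := edge_iff.1 e
    exact h b x y hl

/-- A node with place and label `a` of a pattern of height at most 1 can be mapped to a node with
place and label `b` of a tree. -/
def Fits (a b : Place × Option S) : Prop :=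
  (a.1 = .root ↔ b.1 = .root) ∧ (a.1 = .child → b.1 = .child) ∧ (a.2 ≠ none → b.2 = a.2)

theorem weaklyInjective_iff {T U : PatternTerm S} (hT : T.Proper) (hU : U.Flat) :
    TreePattern.WeaklyInjective T.toPattern U.toPattern ↔
      ∃ f : U.Node → T.Node, Function.Injective f ∧
        ∀ x, Fits (U.place .root x, U.lab x) (T.place .root (f x), T.lab (f x)) := by
  have hU := (flat_iff U).1 hU
  have hT := (isTree_iff T).2 hT
  -- in a tree, the descendants of the root are the nodes other than the root
  have hdesc : ∀ x : T.Node, x ≠ T.root ↔ Relation.TransGen (T.Link false) T.root x := by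
    intro x
    constructor
    · intro hx
      have h := T.toPattern.reachable x
      have h' : Relation.ReflTransGen (T.Link false) T.root x :=
        h.lift id fun a b e => e.resolve_right (hT.1 a b)
      exact (Relation.reflTransGen_iff_eq_or_transGen.1 h').resolve_left hx
    · rintro h rfl
      exact T.toPattern.acyclic _ (h.lift id fun _ _ e => .inl e)
  constructor
  · rintro ⟨f, ⟨hr, hc, hd, hl⟩, hf⟩
    have hr' : f U.root = T.root := hr
    refine ⟨f, hf, fun x => ⟨?_, ?_, hl x⟩⟩
    · refine place_eq_root.trans (Iff.trans ?_ place_eq_root.symm)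
      rw [← hr']
      exact hf.eq_iff.symm
    · intro hx
      have := hc _ _ (place_eq_child.1 hx)
      refine place_eq_child.2 ?_
      rw [← hr']
      exact this
  · rintro ⟨f, hf, h⟩
    have hr : f U.root = T.root := place_eq_root.1 ((h U.root).1.1 (place_root _ _))
    refine ⟨f, ⟨hr, fun x y hl => ?_, fun x y hl => ?_, fun x => (h x).2.2⟩, hf⟩
    · obtain rfl := hU _ _ _ hl
      rw [hr]
      exact place_eq_child.1 ((h y).2.1 (place_eq_child.2 hl))
    · obtain rfl := hU _ _ _ hl
      rw [hr]
      refine (hdesc _).1 fun hy => ?_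
      have := place_eq_root.1 ((h y).1.2 (place_eq_root.2 hy))
      subst this
      exact not_link_root hl

/-- The types of nodes of trees to which a node with type in `s` can be mapped. -/
def fitting (s : Set (Place × Option S)) : Set (Place × Option S) := {b | ∃ a ∈ s, Fits a b}

theorem mem_MInjHeight_iff {T U : PatternTerm S} :
    (T.toPattern, U.toPattern) ∈ TreePattern.MInjHeight S 1 ↔
      T.Proper ∧ U.Flat ∧ ∀ s, U.count s .root ≤ T.count (fitting s) .root := by
  have h : (T.toPattern, U.toPattern) ∈ TreePattern.MInjHeight S 1 ↔ T.Proper ∧ U.Flat ∧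
      TreePattern.WeaklyInjective T.toPattern U.toPattern := by
    rw [← isTree_iff, ← height_le_one_iff, and_comm (a := U.toPattern.height ≤ 1)]
    rfl
  rw [h]
  refine and_congr_right fun hT => and_congr_right fun hU => ?_
  rw [weaklyInjective_iff hT hU]
  have := exists_injective_iff_of_types (fun x : U.Node => (U.place .root x, U.lab x))
    (fun y : T.Node => (T.place .root y, T.lab y)) Fits
  rw [this]
  simp only [count_eq_card]
  rfl

end PatternTerm

/-! ### The counter automaton for the problem -/

namespace MatchingAutomaton

open TreePattern PatternTerm CounterAutomaton

/-- The states of the automaton: failure, or reading the tree or the pattern. In the latter cases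
the state tells whether the label of the current node has been read, and the place of that
node. -/
inductive Control
  | fail
  | tree (labelled : Bool) (q : Place)
  | pattern (labelled : Bool) (q : Place)

instance : Finite Control :=
  Finite.of_surjective (fun x : Option (Bool × Bool × Place) =>
    x.elim Control.fail fun y => cond y.1 (.tree y.2.1 y.2.2) (.pattern y.2.1 y.2.2)) (by
    rintro (_ | ⟨b, q⟩ | ⟨b, q⟩)
    exacts [⟨none, rfl⟩, ⟨some (true, b, q), rfl⟩, ⟨some (false, b, q), rfl⟩])

variable {S : Type}

/-- The counters: `none` stands for the depth of the current node of the tree, minus 2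
(truncated: at depth 0 and 1 the state alone tells the depth), and `some s` for the number of nodes
of the tree with type in `fitting s`, minus the number of nodes of the pattern with type in `s`, as
far as they have been read. -/
abbrev Counter (S : Type) : Type := Option (Set (Place × Option S))

open Classical in
/-- The state transitions. The automaton fails on a node of the pattern if some counter for a type
of this node is already `0`. -/
noncomputable def next : Control → (Counter S → Bool) → Token S → Control
  | .tree false q, _, .label (some _) => .tree true q
  | .tree true q, _, .openChild => .tree false (q.next false)
  | .tree true .child, _, .close => .tree true .root
  | .tree true .deep, z, .close => .tree true (if z none = true then .child else .deep)
  | .tree true .root, _, .sep => .pattern false .root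
  | .pattern false q, z, .label l =>
    if ∃ s, (q, l) ∈ s ∧ z (some s) = true then .fail else .pattern true q
  | .pattern true .root, _, .openChild => .pattern false .child
  | .pattern true .root, _, .openDesc => .pattern false .deep
  | .pattern true .child, _, .close => .pattern true .root
  | .pattern true .deep, _, .close => .pattern true .root
  | _, _, _ => .fail

open Classical in
/-- The operations on the counters. -/
noncomputable def op : Control → Token S → Counter S → CounterOp
  | .tree false q, .label l, some s => if (q, l) ∈ fitting s then .inc else .keep
  | .tree true .deep, .openChild, none => .inc
  | .tree true .deep, .close, none => .dec
  | .pattern false q, .label l, some s => if (q, l) ∈ s then .dec else .keep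
  | _, _, _ => .keep

/-- The counter automaton that decides the problem. -/
noncomputable def automaton (S : Type) : CounterAutomaton (Token S) Control (Counter S) where
  start := .tree false .root
  next := next
  op x _ := op x
  accept x := match x with
    | .pattern true .root => true
    | _ => false

/-- The place of a node of a tree at depth `d`. -/
def placeAt : ℕ → Place
  | 0 => .root
  | 1 => .child
  | _ + 2 => .deep

theorem next_placeAt (d : ℕ) : (placeAt d).next false = placeAt (d + 1) := by
  rcases d with _ | _ | d <;> rfl

/-- The values of the counters, when the current node of the tree has depth `d`. -/
def values (d : ℕ) (c : Set (Place × Option S) → ℕ) : Counter S → ℕ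
  | none => d - 2
  | some s => c s

theorem step_tree_label {l : Option S} (hl : l ≠ none) (d : ℕ) (c : Set (Place × Option S) → ℕ) :
    (automaton S).step (.tree false (placeAt d), values d c) (.label l) =
      (.tree true (placeAt d),
        values d fun s => c s + (leaf l).count (fitting s) (placeAt d)) := by
  obtain ⟨a, rfl⟩ := Option.ne_none_iff_exists'.1 hl
  refine Prod.ext rfl (funext fun i => ?_)
  cases i with
  | none => rfl
  | some s =>
    simp only [step, automaton, op, values, count]
    split_ifs <;> rfl

theorem step_tree_open (d : ℕ) (c : Set (Place × Option S) → ℕ) :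
    (automaton S).step (.tree true (placeAt d), values d c) .openChild =
      (.tree false (placeAt (d + 1)), values (d + 1) c) := by
  rw [← next_placeAt]
  refine Prod.ext rfl (funext fun i => ?_)
  rcases d with _ | _ | d <;> cases i <;> rfl

theorem step_tree_close (d : ℕ) (c : Set (Place × Option S) → ℕ) :
    (automaton S).step (.tree true (placeAt (d + 1)), values (d + 1) c) .close =
      (.tree true (placeAt d), values d c) := by
  rcases d with _ | _ | d
  · exact Prod.ext rfl (funext fun i => by cases i <;> rfl)
  · exact Prod.ext rfl (funext fun i => by cases i <;> rfl)
  · exact Prod.ext rfl (funext fun i => by cases i <;> rfl)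

theorem run_tree {T : PatternTerm S} (hT : T.Proper) (d : ℕ) (c : Set (Place × Option S) → ℕ) :
    (automaton S).run (.tree false (placeAt d), values d c) T.word =
      (.tree true (placeAt d), values d fun s => c s + T.count (fitting s) (placeAt d)) := by
  induction T generalizing d c with
  | leaf l => exact step_tree_label hT d c
  | graft T b U ihT ihU =>
    obtain ⟨hT, rfl, hU⟩ := hT
    rw [word, run_append, ihT hT, run_cons]
    have hb : bracket S false = .openChild := rfl
    rw [hb, step_tree_open, run_append, ihU hU, run_cons, step_tree_close, run_nil]
    simp only [count, next_placeAt, add_assoc]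

theorem run_fail (e : Counter S → ℕ) (w : List (Token S)) :
    ((automaton S).run (.fail, e) w).1 = .fail := by
  induction w generalizing e with
  | nil => rfl
  | cons a w ih =>
    rw [run_cons]
    exact ih _

theorem run_of_fail {x : Control × (Counter S → ℕ)} (hx : x.1 = .fail) (w : List (Token S)) :
    ((automaton S).run x w).1 = .fail := by
  obtain ⟨x, e⟩ := x
  obtain rfl : x = .fail := hx
  exact run_fail e w

theorem exists_zero_iff (q : Place) (l : Option S) (c : Set (Place × Option S) → ℕ) :
    (∃ s, (q, l) ∈ s ∧ zeros (values 0 c) (some s) = true) ↔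
      ¬ ∀ s, (leaf l).count s q ≤ c s := by
  push Not
  refine exists_congr fun s => ?_
  have hz : zeros (values 0 c) (some s) = true ↔ c s = 0 := decide_eq_true_iff
  rw [hz, count.eq_1]
  split_ifs with h <;> simp [h]

theorem step_pattern_label {q : Place} {l : Option S} {c : Set (Place × Option S) → ℕ}
    (h : ∀ s, (leaf l).count s q ≤ c s) :
    (automaton S).step (.pattern false q, values 0 c) (.label l) =
      (.pattern true q, values 0 fun s => c s - (leaf l).count s q) := by
  refine Prod.ext (if_neg fun h' => (exists_zero_iff q l c).1 h' h) (funext fun i => ?_)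
  cases i with
  | none => rfl
  | some s =>
    simp only [step, automaton, op, values, count]
    split_ifs <;> rfl

theorem step_pattern_label_fail {q : Place} {l : Option S} {c : Set (Place × Option S) → ℕ}
    (h : ¬ ∀ s, (leaf l).count s q ≤ c s) :
    ((automaton S).step (.pattern false q, values 0 c) (.label l)).1 = .fail :=
  if_pos ((exists_zero_iff q l c).2 h)

theorem step_pattern_open (b : Bool) (c : Set (Place × Option S) → ℕ) :
    (automaton S).step (.pattern true .root, values 0 c) (bracket S b) =
      (.pattern false (Place.next .root b), values 0 c) := by
  cases b <;> exact Prod.ext rfl (funext fun i => by cases i <;> rfl)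

theorem step_pattern_close (b : Bool) (c : Set (Place × Option S) → ℕ) :
    (automaton S).step (.pattern true (Place.next .root b), values 0 c) .close =
      (.pattern true .root, values 0 c) := by
  cases b <;> exact Prod.ext rfl (funext fun i => by cases i <;> rfl)

theorem run_pattern {U : PatternTerm S} (hU : U.Flat) {c : Set (Place × Option S) → ℕ}
    (h : ∀ s, U.count s .root ≤ c s) :
    (automaton S).run (.pattern false .root, values 0 c) U.word =
      (.pattern true .root, values 0 fun s => c s - U.count s .root) := by
  induction U with
  | leaf l => exact step_pattern_label h
  | graft T b U ih _ =>
    obtain ⟨hT, l, rfl⟩ := hU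
    simp only [count.eq_2] at h
    rw [word, run_append, ih hT fun s => by have := h s; omega, run_cons, step_pattern_open]
    have hl : (leaf l).word ++ [Token.close] = [.label l, .close] := rfl
    rw [hl, run_cons, step_pattern_label fun s => by have := h s; omega, run_cons,
      step_pattern_close, run_nil]
    simp only [count.eq_2, Nat.sub_sub]

theorem run_pattern_fail {U : PatternTerm S} (hU : U.Flat) {c : Set (Place × Option S) → ℕ}
    (h : ¬ ∀ s, U.count s .root ≤ c s) :
    ((automaton S).run (.pattern false .root, values 0 c) U.word).1 = .fail := by
  induction U with
  | leaf l => exact step_pattern_label_fail h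
  | graft T b U ih _ =>
    obtain ⟨hT, l, rfl⟩ := hU
    rw [word, run_append]
    by_cases h₁ : ∀ s, T.count s .root ≤ c s
    · rw [run_pattern hT h₁, run_cons, step_pattern_open]
      have hl : (leaf l).word ++ [Token.close] = [.label l, .close] := rfl
      rw [hl, run_cons]
      refine run_of_fail (step_pattern_label_fail fun h₂ => h fun s => ?_) _
      have := h₁ s
      have := h₂ s
      rw [count.eq_2]
      omega
    · exact run_of_fail (ih hT h₁) _

theorem run_instance {T : PatternTerm S} (hT : T.Proper) (v : List (Token S)) :
    (automaton S).run ((automaton S).start, fun _ => 0) (T.word ++ .sep :: v) =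
      (automaton S).run (.pattern false .root, values 0 fun s => T.count (fitting s) .root) v := by
  have h₀ : ((automaton S).start, fun _ => 0) =
      ((Control.tree false (placeAt 0), values 0 fun _ => 0) : Control × (Counter S → ℕ)) :=
    Prod.ext rfl (funext fun i => by cases i <;> rfl)
  rw [h₀, run_append, run_tree hT, run_cons]
  congr 1
  refine Prod.ext rfl (funext fun i => ?_)
  cases i with
  | none => rfl
  | some s => exact Nat.zero_add _

/-- The word that has been read when the current node of the tree is about to begin, where the terms
in the list (innermost first) are the parts that have been read of its ancestors. -/
def contextWord : List (PatternTerm S) → List (Token S)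
  | [] => []
  | T :: C => contextWord C ++ T.word ++ [.openChild]

/-- What the state and the depth counter tell about the word that has been read. -/
def Invariant (w : List (Token S)) : Control → ℕ → Prop
  | .fail, _ => True
  | .tree false q, n => ∃ C : List (PatternTerm S), (∀ T ∈ C, T.Proper) ∧ w = contextWord C ∧
      q = placeAt C.length ∧ n = C.length - 2
  | .tree true q, n => ∃ (C : List (PatternTerm S)) (T : PatternTerm S), (∀ T ∈ C, T.Proper) ∧
      T.Proper ∧ w = contextWord C ++ T.word ∧ q = placeAt C.length ∧ n = C.length - 2
  | .pattern false q, _ => ∃ T : PatternTerm S, T.Proper ∧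
      (q = .root ∧ w = T.word ++ [.sep] ∨
        ∃ (U : PatternTerm S) (b : Bool), U.Flat ∧ q = Place.next .root b ∧
          w = T.word ++ .sep :: (U.word ++ [bracket S b]))
  | .pattern true q, _ => ∃ T U : PatternTerm S, T.Proper ∧ U.Flat ∧
      (q = .root ∧ w = T.word ++ .sep :: U.word ∨
        ∃ (b : Bool) (l : Option S), q = Place.next .root b ∧
          w = T.word ++ .sep :: (U.word ++ [bracket S b, .label l]))

/-- Only the syntax is tracked here. The other counters are known from `run_tree` and `run_pattern`
as soon as the word is known to consist of the words of two terms. -/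
theorem invariant_step {w : List (Token S)} {x : Control} {e : Counter S → ℕ} (a : Token S)
    (h : Invariant w x (e none)) :
    Invariant (w ++ [a]) ((automaton S).step (x, e) a).1 (((automaton S).step (x, e) a).2 none) := by
  rcases x with _ | ⟨_ | _, q⟩ | ⟨_ | _, q⟩
  · trivial
  · obtain ⟨C, hC, rfl, rfl, hn⟩ := h
    rcases a with (_ | l) | _ | _ | _ | _ <;> try trivial
    exact ⟨C, leaf (some l), hC, Option.some_ne_none l, rfl, rfl, hn⟩
  · obtain ⟨C, T, hC, hT, rfl, rfl, hn⟩ := h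
    rcases a with l | _ | _ | _ | _
    · trivial
    · refine ⟨T :: C, by simpa [hT] using hC, rfl, next_placeAt _, ?_⟩
      rcases hl : C.length with _ | _ | k <;>
        simp [hl, step, automaton, op, placeAt, hn, CounterOp.apply]
    · trivial
    · rcases C with _ | ⟨T', C⟩
      · trivial
      · have hw : contextWord (T' :: C) ++ T.word ++ [.close] =
            contextWord C ++ (graft T' false T).word := by
          simp [contextWord, word, bracket]
        have hT' : T'.Proper := hC T' (by simp)
        have hC' : ∀ T ∈ C, T.Proper := fun T hT => hC T (by simp [hT])
        rw [hw]
        rcases hl : C.length with _ | _ | k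
        · simp only [List.length_cons, hl, placeAt] at hn ⊢
          exact ⟨C, graft T' false T, hC', ⟨hT', rfl, hT⟩, rfl, by simp [hl, placeAt],
            by simp [hl, step, automaton, op, hn, CounterOp.apply]⟩
        · simp only [List.length_cons, hl, placeAt] at hn ⊢
          refine ⟨C, graft T' false T, hC', ⟨hT', rfl, hT⟩, rfl, ?_,
            by simp [hl, step, automaton, op, hn, CounterOp.apply]⟩
          simp [hl, placeAt, zeros, hn]
        · simp only [List.length_cons, hl, placeAt] at hn ⊢
          refine ⟨C, graft T' false T, hC', ⟨hT', rfl, hT⟩, rfl, ?_,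
            by simp [hl, step, automaton, op, hn, CounterOp.apply]⟩
          simp [hl, placeAt, zeros, hn]
    · rcases C with _ | ⟨T', _ | ⟨T'', C⟩⟩
      · exact ⟨T, hT, .inl ⟨rfl, rfl⟩⟩
      · trivial
      · trivial
  · obtain ⟨T, hT, h⟩ := h
    rcases a with l | _ | _ | _ | _ <;> try trivial
    by_cases hz : ∃ s, (q, l) ∈ s ∧ zeros e (some s) = true
    · have : ((automaton S).step (.pattern false q, e) (.label l)).1 = .fail := if_pos hz
      rw [this]
      trivial
    · have : ((automaton S).step (.pattern false q, e) (.label l)).1 = .pattern true q :=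
        if_neg hz
      rw [this]
      rcases h with ⟨rfl, rfl⟩ | ⟨U, b, hU, rfl, rfl⟩
      · exact ⟨T, leaf l, hT, trivial, .inl ⟨rfl, by simp [word]⟩⟩
      · exact ⟨T, U, hT, hU, .inr ⟨b, l, rfl, by simp⟩⟩
  · obtain ⟨T, U, hT, hU, ⟨rfl, rfl⟩ | ⟨b, l, rfl, rfl⟩⟩ := h
    · rcases a with l | _ | _ | _ | _ <;> try trivial
      · exact ⟨T, hT, .inr ⟨U, false, hU, rfl, by simp [bracket]⟩⟩
      · exact ⟨T, hT, .inr ⟨U, true, hU, rfl, by simp [bracket]⟩⟩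
    · rcases a with l | _ | _ | _ | _ <;> cases b <;> try trivial
      · exact ⟨T, graft U false (leaf l), hT, ⟨hU, l, rfl⟩, .inl ⟨rfl, by simp [word]⟩⟩
      · exact ⟨T, graft U true (leaf l), hT, ⟨hU, l, rfl⟩, .inl ⟨rfl, by simp [word]⟩⟩

theorem invariant_run (w : List (Token S)) :
    Invariant w ((automaton S).run ((automaton S).start, fun _ => 0) w).1
      (((automaton S).run ((automaton S).start, fun _ => 0) w).2 none) := by
  induction w using List.reverseRecOn with
  | nil => exact ⟨[], by simp, rfl, rfl, rfl⟩
  | append_singleton w a ih =>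
    rw [run_append]
    exact invariant_step a ih

theorem accepts_iff (w : List (Token S)) :
    (automaton S).accepts w = true ↔ ∃ T U : PatternTerm S, (T.Proper ∧ U.Flat ∧
      ∀ s, U.count s .root ≤ T.count (fitting s) .root) ∧ w = T.word ++ .sep :: U.word := by
  constructor
  · intro h
    have hx : ((automaton S).run ((automaton S).start, fun _ => 0) w).1 = .pattern true .root := by
      revert h
      unfold accepts
      generalize ((automaton S).run ((automaton S).start, fun _ => 0) w).1 = x
      rcases x with _ | ⟨_ | _, q⟩ | ⟨_ | _, _ | _ | _⟩ <;> simp [automaton]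
    have hw := invariant_run w
    rw [hx] at hw
    obtain ⟨T, U, hT, hU, ⟨-, rfl⟩ | ⟨b, _, hb, -⟩⟩ := hw
    · refine ⟨T, U, ⟨hT, hU, ?_⟩, rfl⟩
      by_contra hc
      rw [run_instance hT, run_pattern_fail hU hc] at hx
      cases hx
    · exact absurd hb.symm (Place.next_ne_root _ _)
  · rintro ⟨T, U, ⟨hT, hU, hc⟩, rfl⟩
    unfold accepts
    rw [run_instance hT, run_pattern hU hc]
    rfl

end MatchingAutomaton

/-- For a fixed finite set `S` of labels, weakly-injective embedding checking for tree patterns of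
height at most 1 is in P. -/
theorem proposition3 (S : Type) [Finite S] :
    InP (TreePattern.problemLanguage (TreePattern.MInjHeight S 1)) := by
  have : Finite (TreePattern.Token S) :=
    Finite.of_surjective (fun x : Option S ⊕ Fin 4 => x.elim TreePattern.Token.label
      ![.openChild, .openDesc, .close, .sep]) (by
      rintro (l | _ | _ | _ | _)
      exacts [⟨.inl l, rfl⟩, ⟨.inr 0, rfl⟩, ⟨.inr 1, rfl⟩, ⟨.inr 2, rfl⟩, ⟨.inr 3, rfl⟩])
  refine (MatchingAutomaton.automaton S).inP _ fun w => ?_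
  rw [MatchingAutomaton.accepts_iff, PatternTerm.mem_problemLanguage]
  simp only [PatternTerm.mem_MInjHeight_iff]
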